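/- Let $C^2(\mathbb R^d)$ be the space of twice continuously differentiable functions $\mathbb R^d\to\mathbb R$ with the topology of uniform convergence on compact sets of the functions and of their first and second partial derivatives. Add to $\mathbb R^d$ and to the space of real $d\times d$ matrices an isolated point NaO ("not an object") that propagates through all operations. For $q\in C^2(\mathbb R^d)$ and $\delta\in\mathbb R^d$ let the one-step Newton map be $$G(q,\delta)=\delta+\bigl(-\nabla^2q(\delta)\bigr)^{-1}\nabla q(\delta)$$ if $-\nabla^2 q(\delta)$ is positive definite, and $G(q,\delta)=\mathrm{NaO}$ otherwise; write $A^{1/2}$ for the symmetric square root of $A$ if $A$ is a positive definite matrix, and $A^{1/2}=\mathrm{NaO}$ otherwise. For each $n$ let $(q_n,\tilde\delta_n)$ be a random element of $C^2(\mathbb R^d)\times\mathbb R^d$, on a probability space that may depend on $n$ (in applications $q_n$ is a log likelihood with parameter space $\mathbb R^d$ and true parameter value zero). Suppose that $$(q_n,\tilde\delta_n)\Rightarrow(q,\tilde\delta)\qquad\text{in } C^2(\mathbb R^d)\times\mathbb R^d ,$$ where, under the parameter value zero, $q$ is the log likelihood of an LAMN model with constant $K$: there is a family $(P_\theta)_{\theta\in\mathbb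 R^d}$ of probability measures on one measurable space, having almost surely positive densities $f_\theta$ with respect to a common measure, $(q,\tilde\delta)$ being considered under $P_0$, such that for every $\theta$, almost surely, $q(\theta)=u+\log f_\theta$ with $u$ not depending on $\theta$, and such that almost surely $$q(\delta)=\delta'Z-\tfrac12\delta'K\delta\qquad\text{for all }\delta\in\mathbb R^d$$ with $Z$ a random vector and $K$ a constant symmetric positive definite $d\times d$ matrix. Let $\hat\delta_n=G(q_n,\tilde\delta_n)$. Then $$\hat\delta_n\Rightarrow N(0,K^{-1}).$$ Moreover, this convergence, in the form $\hat\delta_n\Rightarrow K^{-1}Z$ with $K^{-1}Z\sim N(0,K^{-1})$, holds jointly with $(q_n,\tilde\delta_n)\Rightarrow(q,\tilde\delta)$, with $-\nabla^2q_n(\tilde\delta_n)\Rightarrow K$, with $-\nabla^2q_n(\hat\delta_n)\Rightarrow K$, and with $\bigl(-\nabla^2q_n(\hat\delta_n)\bigr)^{1/2}\hat\delta_n\Rightarrow K^{-1/2}Z\sim N(0,I)$. -/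

import Mathlib

open MeasureTheory ProbabilityTheory Filter Topology

namespace Quadraticity

/-- The parameter space `ℝ^d`, with its Euclidean structure. -/
abbrev Par (d : ℕ) : Type := EuclideanSpace ℝ (Fin d)

/-- Real `d × d` matrices. -/
abbrev Mat (d : ℕ) : Type := Matrix (Fin d) (Fin d) ℝ

/-- The Borel σ-algebra on matrices, which is the product σ-algebra of the entries. -/
instance Mat.measurableSpace (d : ℕ) : MeasurableSpace (Mat d) :=
  inferInstanceAs (MeasurableSpace (Fin d → Fin d → ℝ))

instance Mat.borelSpace (d : ℕ) : BorelSpace (Mat d) :=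
  inferInstanceAs (BorelSpace (Fin d → Fin d → ℝ))

instance Mat.secondCountableTopology (d : ℕ) : SecondCountableTopology (Mat d) :=
  inferInstanceAs (SecondCountableTopology (Fin d → Fin d → ℝ))

/-- The matrix-vector product `A v` on `ℝ^d`. -/
def act {d : ℕ} (A : Mat d) (v : Par d) : Par d := WithLp.toLp 2 (A.mulVec v.ofLp)

/-! ### The space `C²(ℝ^d)` -/

/-- Twice continuously differentiable functions `ℝ^d → ℝ`. -/
structure C2 (d : ℕ) where
  /-- the underlying function -/
  toFun : Par d → ℝ
  contDiff : ContDiff ℝ 2 toFun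

namespace C2

variable {d : ℕ}

instance coeFun : CoeFun (C2 d) (fun _ => Par d → ℝ) := ⟨C2.toFun⟩

/-- The `i`-th standard basis vector of `ℝ^d`. -/
noncomputable def basisVec (i : Fin d) : Par d := EuclideanSpace.single i 1

theorem continuous_fderiv (q : C2 d) : Continuous (fderiv ℝ q.toFun) :=
  q.contDiff.continuous_fderiv (by norm_num)

theorem continuous_fderiv_fderiv (q : C2 d) : Continuous (fderiv ℝ (fderiv ℝ q.toFun)) :=
  (q.contDiff.fderiv_right (m := 1) (by norm_num)).continuous_fderiv (by norm_num)

/-- The function itself, as a continuous function. -/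
def val (q : C2 d) : C(Par d, ℝ) := ⟨q.toFun, q.contDiff.continuous⟩

/-- The gradient `∇q`, the vector of first partial derivatives, as a continuous function. -/
noncomputable def grad (q : C2 d) : C(Par d, Par d) where
  toFun x := WithLp.toLp 2 fun i => fderiv ℝ q.toFun x (basisVec i)
  continuous_toFun := by
    refine (PiLp.continuous_toLp 2 _).comp (continuous_pi fun i => ?_)
    exact q.continuous_fderiv.clm_apply continuous_const

/-- The Hessian `∇²q`, the matrix of second partial derivatives, as a continuous function. -/
noncomputable def hess (q : C2 d) : C(Par d, Mat d) where
  toFun x := Matrix.of fun i j => fderiv ℝ (fderiv ℝ q.toFun) x (basisVec i) (basisVec j)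
  continuous_toFun := by
    refine continuous_matrix fun i j => ?_
    exact (q.continuous_fderiv_fderiv.clm_apply continuous_const).clm_apply continuous_const

/-- The topology of uniform convergence on compact sets of the function and of its first and
second partial derivatives (`C(X, Y)` carries the compact-open topology). -/
noncomputable instance topologicalSpace : TopologicalSpace (C2 d) :=
  TopologicalSpace.induced (fun q => (q.val, q.grad, q.hess)) inferInstance

/-- Random elements of `C²(ℝ^d)` are measurable for the Borel σ-algebra. -/
noncomputable instance measurableSpace : MeasurableSpace (C2 d) := borel (C2 d)

instance borelSpace : BorelSpace (C2 d) := ⟨rfl⟩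

end C2

/-! ### Adding the isolated point NaO (not an object) -/

/-- The space `X` with a new isolated point NaO added: the topological disjoint sum of `X` and
a point. -/
abbrev WithNaO (X : Type*) : Type _ := X ⊕ Unit

/-- The extra point NaO. -/
abbrev NaO {X : Type*} : WithNaO X := Sum.inr ()

/-- An ordinary point. -/
abbrev obj {X : Type*} (x : X) : WithNaO X := Sum.inl x

/-- The σ-algebra of a disjoint sum contains its open sets. -/
instance opensMeasurableSpace_sum {X Y : Type*} [TopologicalSpace X] [MeasurableSpace X] [OpensMeasurableSpace X]
    [TopologicalSpace Y] [MeasurableSpace Y] [OpensMeasurableSpace Y] :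
    OpensMeasurableSpace (X ⊕ Y) where
  borel_le := by
    refine MeasurableSpace.generateFrom_le fun s hs => ?_
    rw [measurableSet_sum_iff]
    exact ⟨(isOpen_sum_iff.1 hs).1.measurableSet, (isOpen_sum_iff.1 hs).2.measurableSet⟩

/-- The joint convergence takes place in this product space. -/
instance opensMeasurableSpace_joint (d : ℕ) : OpensMeasurableSpace
    (C2 d × Par d × Mat d × WithNaO (Mat d) × WithNaO (Par d) × WithNaO (Par d)) := by
  have : OpensMeasurableSpace (WithNaO (Mat d) × WithNaO (Par d) × WithNaO (Par d)) :=
    inferInstance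
  have : OpensMeasurableSpace (Mat d × WithNaO (Mat d) × WithNaO (Par d) × WithNaO (Par d)) :=
    Prod.opensMeasurableSpace
  have : OpensMeasurableSpace
      (Par d × Mat d × WithNaO (Mat d) × WithNaO (Par d) × WithNaO (Par d)) :=
    Prod.opensMeasurableSpace
  exact Prod.opensMeasurableSpace

/-! ### The Newton map and the derived statistics; NaO propagates -/

open Classical in
/-- The one-step Newton map `G(q, δ) = δ + (-∇²q(δ))⁻¹ ∇q(δ)` when `-∇²q(δ)` is positive
definite, and NaO otherwise. -/
noncomputable def newton {d : ℕ} (q : C2 d) : WithNaO (Par d) → WithNaO (Par d)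
  | Sum.inl δ => if (-q.hess δ).PosDef then obj (δ + act (-q.hess δ)⁻¹ (q.grad δ)) else NaO
  | Sum.inr _ => NaO

/-- Minus the Hessian, `-∇²q(δ)`, with NaO propagating. -/
noncomputable def negHess {d : ℕ} (q : C2 d) : WithNaO (Par d) → WithNaO (Mat d)
  | Sum.inl δ => obj (-q.hess δ)
  | Sum.inr _ => NaO

open Classical MatrixOrder in
/-- The symmetric square root of a positive definite matrix, NaO for other matrices. -/
noncomputable def sqrtNaO {d : ℕ} : WithNaO (Mat d) → WithNaO (Mat d)
  | Sum.inl A => if A.PosDef then obj (CFC.sqrt A) else NaO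
  | Sum.inr _ => NaO

/-- The matrix-vector product with NaO propagating. -/
def actNaO {d : ℕ} : WithNaO (Mat d) → WithNaO (Par d) → WithNaO (Par d)
  | Sum.inl A, Sum.inl v => obj (act A v)
  | _, _ => NaO

/-! ### Log likelihoods and LAMN models -/

/-- `l` is a log likelihood of the statistical model `P` with sample space `Ω` and parameter space
`ℝ^d`: the distributions `P θ` have almost surely positive densities `f θ` with respect to a
measure `lam`, and `l(θ) = u + log (f θ)` almost surely, `u` not depending on the parameter. -/
def IsLogLikelihood {d : ℕ} {Ω : Type*} [MeasurableSpace Ω] (P : Par d → Measure Ω)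
    (l : Ω → Par d → ℝ) : Prop :=
  ∃ (lam : Measure Ω) (f : Par d → Ω → ℝ) (u : Ω → ℝ),
    (∀ θ, Measurable (f θ)) ∧
    (∀ θ, ∀ᵐ ω ∂lam, 0 < f θ ω) ∧
    (∀ θ, P θ = lam.withDensity fun ω => ENNReal.ofReal (f θ ω)) ∧
    ∀ θ, ∀ᵐ ω ∂lam, l ω θ = u ω + Real.log (f θ ω)

/-- `q` is the log likelihood of an LAMN model, the family `P` of distributions:
`q(δ) = δ' Z - δ' K δ / 2`, where the random matrix `K` is symmetric and positive definite almost
surely, and the distribution of `K` does not depend on the parameter. -/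
structure IsLAMN {d : ℕ} {Ω : Type*} [MeasurableSpace Ω] (P : Par d → Measure Ω)
    (q : Ω → C2 d) (Z : Ω → Par d) (K : Ω → Mat d) : Prop where
  isProbabilityMeasure : ∀ θ, IsProbabilityMeasure (P θ)
  isLogLikelihood : IsLogLikelihood P fun ω θ => q ω θ
  aemeasurable_Z : ∀ θ, AEMeasurable Z (P θ)
  aemeasurable_K : ∀ θ, AEMeasurable K (P θ)
  quadratic : ∀ᵐ ω ∂P 0, ∀ δ : Par d,
    q ω δ = δ.ofLp ⬝ᵥ (Z ω).ofLp - (1 / 2) * (δ.ofLp ⬝ᵥ (K ω).mulVec δ.ofLp)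
  posDef : ∀ᵐ ω ∂P 0, (K ω).PosDef
  invariant : ∀ θ, (P θ).map K = (P 0).map K

end Quadraticity

open Quadraticity

/-!
The joint statistic is a fixed map `newtonStatistics` of the pair `(q, δ)`. It is Borel, and it is
continuous on the open set `sqrtDomain` of pairs at which neither NaO occurs: symmetric positive
definite matrices form an open subset of the symmetric matrices, Hessians of `C²` functions are
symmetric, and the inverse and the square root are continuous at positive definite matrices. A
quadratic `q(δ) = δ'Z - δ'Kδ/2` has Hessian `-K` everywhere and its Newton step from any point
lands at `K⁻¹Z`, so almost surely the limit lies in `sqrtDomain` and is sent to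
`(q, δ, K, K, K⁻¹Z, K^{-1/2}Z)`. The joint convergence is then the continuous mapping theorem for a
map that is continuous on an open set carrying the limit law
(`tendstoInDistribution_comp_of_continuousOn_isOpen`), which the portmanteau theorem gives.

The law of `Z` comes from the likelihood structure. As `exp (q(θ) - q(0))` is the density of `P θ`
with respect to `P 0`, it has expectation one under `P 0`. For the quadratic `q` this says that
`E exp(θ'Z) = exp(θ'Kθ/2)` for all `θ`, which is the moment generating function of `N(0, K)`
(`IsLAMN.hasLaw_multivariateGaussian`).
-/

namespace Quadraticity

/-! ### The continuous mapping theorem on an open set -/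

theorem measurableSet_borel_image_of_isOpenEmbedding {X Y : Type*} [TopologicalSpace X]
    [MeasurableSpace X] [BorelSpace X] [TopologicalSpace Y] {f : X → Y} (hf : IsOpenEmbedding f)
    {s : Set X} (hs : MeasurableSet s) : MeasurableSet[borel Y] (f '' s) := by
  let := borel Y
  have : BorelSpace Y := ⟨rfl⟩
  exact hf.measurableEmbedding.measurableSet_image' hs

instance borelSpace_sum {X Y : Type*} [TopologicalSpace X] [MeasurableSpace X] [BorelSpace X]
    [TopologicalSpace Y] [MeasurableSpace Y] [BorelSpace Y] : BorelSpace (X ⊕ Y) where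
  measurable_eq := by
    refine le_antisymm (fun s hs => ?_) OpensMeasurableSpace.borel_le
    rw [← Set.image_preimage_inl_union_image_preimage_inr s]
    exact @MeasurableSet.union _ (borel _) _ _
      (measurableSet_borel_image_of_isOpenEmbedding .inl (measurableSet_sum_iff.1 hs).1)
      (measurableSet_borel_image_of_isOpenEmbedding .inr (measurableSet_sum_iff.1 hs).2)

/-- **Continuous mapping theorem** for a Borel map that is only continuous on an open set `U`
carrying the limit law. For `G` open, `U ∩ g⁻¹(G)` is open and has the same limit probability as
`g⁻¹(G)`, so the open-set form of the portmanteau theorem transfers from `X` to `g ∘ X`. -/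
theorem tendstoInDistribution_comp_of_continuousOn_isOpen {ι E F Ω' : Type*} {Ω : ι → Type*}
    [∀ i, MeasurableSpace (Ω i)] {μ : (i : ι) → Measure (Ω i)} [∀ i, IsProbabilityMeasure (μ i)]
    [MeasurableSpace Ω'] {μ' : Measure Ω'} [IsProbabilityMeasure μ']
    [TopologicalSpace E] [MeasurableSpace E] [OpensMeasurableSpace E] [HasOuterApproxClosed E]
    [TopologicalSpace F] [MeasurableSpace F] [OpensMeasurableSpace F]
    {X : (i : ι) → Ω i → E} {Z : Ω' → E} {l : Filter ι} [l.IsCountablyGenerated]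
    (h : TendstoInDistribution X l Z μ μ') {g : E → F} {U : Set E} (hg : Measurable g)
    (hU : IsOpen U) (hgU : ContinuousOn g U) (hZ : ∀ᵐ ω ∂μ', Z ω ∈ U) :
    TendstoInDistribution (fun i ω => g (X i ω)) l (fun ω => g (Z ω)) μ μ' where
  forall_aemeasurable i := hg.comp_aemeasurable (h.forall_aemeasurable i)
  aemeasurable_limit := hg.comp_aemeasurable h.aemeasurable_limit
  tendsto := by
    refine tendsto_of_forall_isOpen_le_liminf' fun G hG => ?_
    have hV : IsOpen (U ∩ g ⁻¹' G) := hgU.isOpen_inter_preimage hU hG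
    have key := ProbabilityMeasure.le_liminf_measure_open_of_tendsto h.tendsto hV
    simp only [ProbabilityMeasure.coe_mk] at key ⊢
    have hgX : ∀ i, AEMeasurable (fun ω => g (X i ω)) (μ i) := fun i =>
      hg.comp_aemeasurable (h.forall_aemeasurable i)
    have hgZ : AEMeasurable (fun ω => g (Z ω)) μ' := hg.comp_aemeasurable h.aemeasurable_limit
    calc μ'.map (fun ω => g (Z ω)) G = μ'.map Z (U ∩ g ⁻¹' G) := by
          rw [Measure.map_apply_of_aemeasurable hgZ hG.measurableSet,
            Measure.map_apply_of_aemeasurable h.aemeasurable_limit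
            hV.measurableSet]
          refine measure_congr ?_
          filter_upwards [hZ] with ω hω
          exact propext ⟨fun hx => ⟨hω, hx⟩, fun hx => hx.2⟩
      _ ≤ _ := key
      _ ≤ _ := by
          refine liminf_le_liminf (Eventually.of_forall fun i => ?_)
          rw [Measure.map_apply_of_aemeasurable (hgX i) hG.measurableSet,
            Measure.map_apply_of_aemeasurable (h.forall_aemeasurable i)
            hV.measurableSet]
          exact measure_mono fun ω hω => hω.2

variable {d : ℕ} {Ω' : Type*} [MeasurableSpace Ω']

/-! ### Gradient and Hessian on `C²(ℝ^d)` -/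

/-- The topology is induced from a product of spaces `C(ℝ^d, Y)`, which are metrizable because
`ℝ^d` is σ-compact and locally compact. -/
instance C2.pseudoMetrizableSpace : TopologicalSpace.PseudoMetrizableSpace (C2 d) :=
  Topology.IsInducing.pseudoMetrizableSpace
    (f := fun q : C2 d => (q.val, q.grad, q.hess)) ⟨rfl⟩

/-- Needed for the portmanteau theorem; the product inherits pseudometrizability from its factors. -/
instance : HasOuterApproxClosed (C2 d × Par d) :=
  letI := TopologicalSpace.pseudoMetrizableSpacePseudoMetric (C2 d × Par d)
  inferInstance

theorem C2.continuous_derivatives :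
    Continuous fun q : C2 d => (q.val, q.grad, q.hess) :=
  continuous_induced_dom

theorem C2.continuous_grad_apply : Continuous fun p : C2 d × Par d => p.1.grad p.2 :=
  ((C2.continuous_derivatives.snd.fst).comp continuous_fst).eval continuous_snd

theorem C2.continuous_hess_apply : Continuous fun p : C2 d × Par d => p.1.hess p.2 :=
  ((C2.continuous_derivatives.snd.snd).comp continuous_fst).eval continuous_snd

theorem C2.isSymm_hess (q : C2 d) (x : Par d) : (q.hess x).IsSymm := by
  ext i j
  exact (q.contDiff.contDiffAt.isSymmSndFDerivAt (by simp)) _ _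

/-! ### Positive definite matrices -/

theorem continuous_act : Continuous fun p : Mat d × Par d => act p.1 p.2 :=
  (PiLp.continuous_toLp 2 _).comp
    (continuous_fst.matrix_mulVec ((PiLp.continuous_ofLp 2 _).comp continuous_snd))

theorem continuousAt_inv_of_posDef {A : Mat d} (hA : A.PosDef) : ContinuousAt (·⁻¹) A := by
  refine continuousAt_matrix_inv _ ?_
  rw [Ring.inverse_eq_inv']
  exact continuousAt_inv₀ hA.det_pos.ne'

open MatrixOrder in
theorem continuousOn_sqrt_posDef : ContinuousOn (CFC.sqrt : Mat d → Mat d) {A | A.PosDef} := by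
  have h : ContinuousOn (CFC.sqrt : Mat d → Mat d) {A | 0 ≤ A} := by
    open scoped Matrix.Norms.L2Operator in exact CFC.continuousOn_sqrt
  exact h.mono fun A hA => Matrix.PosDef.posSemidef hA |>.nonneg

/-- Positive definiteness is an open condition along a continuous family of symmetric matrices.
Symmetry is needed: it is part of `Matrix.PosDef` and is not open among all matrices. -/
theorem isOpen_posDef_of_isSymm {E : Type*} [TopologicalSpace E] {A : E → Mat d}
    (hA : Continuous A) (hs : ∀ x, (A x).IsSymm) : IsOpen {x | (A x).PosDef} := by
  have hiff : ∀ x, (A x).PosDef ↔ ∀ v ∈ Metric.sphere (0 : Par d) 1,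
      0 < v.ofLp ⬝ᵥ (A x).mulVec v.ofLp := by
    intro x
    refine ⟨fun h v hv => ?_, fun h => .of_dotProduct_mulVec_pos ?_ fun v hv => ?_⟩
    · have := h.dotProduct_mulVec_pos (x := v.ofLp) (by
        intro h0
        have : v = 0 := by ext i; exact congrFun h0 i
        simp [this] at hv)
      simpa using this
    · rw [Matrix.IsHermitian, Matrix.conjTranspose_eq_transpose_of_trivial]
      exact hs x
    · have hv' : WithLp.toLp 2 v ≠ (0 : Par d) := fun h0 => hv (by
        ext i; exact congrFun (congrArg WithLp.ofLp h0) i)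
      have hn : 0 < ‖WithLp.toLp 2 v‖ := norm_pos_iff.2 hv'
      have := h (‖WithLp.toLp 2 v‖⁻¹ • WithLp.toLp 2 v) (by
        simp [norm_smul, hn.ne'])
      simp only [WithLp.ofLp_smul, Matrix.mulVec_smul, smul_dotProduct, dotProduct_smul,
        smul_eq_mul] at this
      have h2 := pos_of_mul_pos_right (pos_of_mul_pos_right this (by positivity)) (by positivity)
      simpa using h2
  -- By homogeneity it is enough to test unit vectors; their sphere is compact, so positivity at
  -- all of them persists near `x`.
  simp_rw [hiff]
  rw [isOpen_iff_eventually]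
  intro x hx
  refine (isCompact_sphere (0 : Par d) 1).eventually_forall_of_forall_eventually fun v hv => ?_
  have hc : Continuous fun p : E × Par d => p.2.ofLp ⬝ᵥ (A p.1).mulVec p.2.ofLp := by
    have h2 : Continuous fun p : E × Par d => p.2.ofLp :=
      (PiLp.continuous_ofLp 2 _).comp continuous_snd
    exact h2.dotProduct ((hA.comp continuous_fst).matrix_mulVec h2)
  exact hc.continuousAt.eventually (lt_mem_nhds (hx v hv))

/-! ### Partially defined maps, completed by NaO -/

section
open Classical

variable {E X : Type*} [TopologicalSpace E] [TopologicalSpace X] {U : Set E} {f : E → X}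

theorem continuousOn_ite_obj (hf : ContinuousOn f U) :
    ContinuousOn (fun x => if x ∈ U then (obj (f x) : WithNaO X) else NaO) U :=
  (continuous_inl.comp_continuousOn hf).congr fun x hx => by simp [hx]

theorem measurable_ite_obj [MeasurableSpace E] [OpensMeasurableSpace E] [MeasurableSpace X]
    [BorelSpace X] (hU : IsOpen U) (hf : ContinuousOn f U) :
    Measurable (fun x => if x ∈ U then (obj (f x) : WithNaO X) else NaO) :=
  ContinuousOn.measurable_piecewise (f := fun x => (obj (f x) : WithNaO X)) (g := fun _ => NaO)
    (continuous_inl.comp_continuousOn hf) continuousOn_const hU.measurableSet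

end

/-! ### The Gaussian law -/

theorem act_eq_toEuclideanCLM (A : Mat d) (v : Par d) :
    act A v = Matrix.toEuclideanCLM (𝕜 := ℝ) A v := rfl

/-- `exp (l(θ) - l(0))` is the density of `P θ` with respect to `P 0`, so it integrates to one. -/
theorem IsLogLikelihood.lintegral_exp_sub_eq_one {P : Par d → Measure Ω'}
    [∀ θ, IsProbabilityMeasure (P θ)] {l : Ω' → Par d → ℝ} (h : IsLogLikelihood P l) (θ : Par d) :
    ∫⁻ ω, ENNReal.ofReal (Real.exp (l ω θ - l ω 0)) ∂P 0 = 1 := by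
  obtain ⟨lam, f, u, hfm, hpos, hP, hl⟩ := h
  have hac : P 0 ≪ lam := by rw [hP 0]; exact withDensity_absolutelyContinuous _ _
  have h1 : ∫⁻ ω, ENNReal.ofReal (Real.exp (l ω θ - l ω 0)) ∂P 0 =
      ∫⁻ ω, ENNReal.ofReal (f θ ω / f 0 ω) ∂P 0 := by
    refine lintegral_congr_ae (hac.ae_le ?_)
    filter_upwards [hpos θ, hpos 0, hl θ, hl 0] with ω hθ h0 e1 e2
    rw [e1, e2, add_sub_add_left_eq_sub, Real.exp_sub, Real.exp_log hθ, Real.exp_log h0]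
  have h2 : P θ Set.univ = ∫⁻ ω, ENNReal.ofReal (f θ ω) ∂lam := by
    rw [hP θ, withDensity_apply _ MeasurableSet.univ, Measure.restrict_univ]
  rw [h1, hP 0, lintegral_withDensity_eq_lintegral_mul _ (hfm 0).ennreal_ofReal
    (g := fun ω => ENNReal.ofReal (f θ ω / f 0 ω)) ((hfm θ).div (hfm 0)).ennreal_ofReal,
    ← measure_univ (μ := P θ), h2]
  refine lintegral_congr_ae ?_
  filter_upwards [hpos 0] with ω h0
  rw [Pi.mul_apply, ← ENNReal.ofReal_mul h0.le, mul_div_cancel₀ _ h0.ne']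

/-- The hypothesis says that `θ'Z` has the moment generating function of `N(0, θ'Kθ)` for every
`θ`. By analytic continuation the characteristic functions agree too. -/
theorem hasLaw_multivariateGaussian_of_lintegral_exp {ν : Measure Ω'} [IsProbabilityMeasure ν]
    {Z : Ω' → Par d} (hZ : AEMeasurable Z ν) {K : Mat d} (hK : K.PosSemidef)
    (h : ∀ θ : Par d, ∫⁻ ω, ENNReal.ofReal (Real.exp (θ.ofLp ⬝ᵥ (Z ω).ofLp -
      (1 / 2) * (θ.ofLp ⬝ᵥ K.mulVec θ.ofLp))) ∂ν = 1) :
    HasLaw Z (multivariateGaussian 0 K) ν := by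
  have : IsProbabilityMeasure (ν.map Z) := Measure.isProbabilityMeasure_map hZ
  refine ⟨hZ, Measure.ext_of_charFun ?_⟩
  ext t
  rw [charFun_multivariateGaussian hK]
  have hv : 0 ≤ t.ofLp ⬝ᵥ K.mulVec t.ofLp := by simpa using hK.dotProduct_mulVec_nonneg t.ofLp
  obtain ⟨v, hv⟩ : ∃ v : NNReal, (v : ℝ) = t.ofLp ⬝ᵥ K.mulVec t.ofLp := ⟨_, Real.coe_toNNReal _ hv⟩
  have hmgf : mgf (fun ω => inner ℝ t (Z ω)) ν = mgf id (gaussianReal 0 v) := by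
    rw [mgf_id_gaussianReal]
    ext s
    -- The value at `s` of the moment generating function of `t'Z` is the hypothesis at `θ = s t`.
    have hs := h (s • t)
    simp only [WithLp.ofLp_smul, Matrix.mulVec_smul, smul_dotProduct, dotProduct_smul,
      smul_eq_mul] at hs
    have e : ∀ ω, t.ofLp ⬝ᵥ (Z ω).ofLp = inner ℝ t (Z ω) := fun ω => by
      simp [EuclideanSpace.inner_eq_star_dotProduct, dotProduct_comm]
    simp only [e, Real.exp_sub, div_eq_mul_inv] at hs
    have hint : ∀ c : ℝ, 0 ≤ c → ∫⁻ ω, ENNReal.ofReal (Real.exp (s * inner ℝ t (Z ω)) * c) ∂ν =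
        (∫⁻ ω, ENNReal.ofReal (Real.exp (s * inner ℝ t (Z ω))) ∂ν) * ENNReal.ofReal c := by
      intro c hc
      rw [← lintegral_mul_const' _ _ ENNReal.ofReal_ne_top]
      exact lintegral_congr fun ω => ENNReal.ofReal_mul (Real.exp_pos _).le
    rw [hint _ (by positivity)] at hs
    rw [mgf, integral_eq_lintegral_of_nonneg_ae (Eventually.of_forall fun ω => (Real.exp_pos _).le)
      (by fun_prop)]
    have hs' := congrArg ENNReal.toReal hs
    rw [ENNReal.toReal_mul, ENNReal.toReal_ofReal (by positivity), ENNReal.toReal_one] at hs'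
    rw [(div_eq_one_iff_eq (Real.exp_pos _).ne').1 hs', hv]
    ring_nf
  have hset : integrableExpSet (fun ω => inner ℝ t (Z ω)) ν = Set.univ := by
    rw [integrableExpSet_eq_of_mgf hmgf, integrableExpSet_id_gaussianReal]
  -- The complex moment generating functions agree on the whole plane, in particular at `i`.
  have hc := eqOn_complexMGF_of_mgf hmgf (x := Complex.I) (by simp [hset])
  rw [complexMGF_id_gaussianReal] at hc
  have h1 : charFun (ν.map Z) t = complexMGF (fun ω => inner ℝ t (Z ω)) ν Complex.I := by
    rw [charFun_apply, integral_map hZ (by fun_prop), complexMGF]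
    simp_rw [real_inner_comm t, mul_comm Complex.I]
  rw [h1, hc]
  congr 1
  rw [hv, inner_zero_right, Complex.I_sq]
  push_cast
  ring

theorem map_act_multivariateGaussian {K : Mat d} (hK : K.PosSemidef) (A : Mat d) :
    (multivariateGaussian 0 K).map (act A) = multivariateGaussian 0 (A * K * A.transpose) := by
  have hm : Measurable (act A) :=
    (Matrix.toEuclideanCLM (𝕜 := ℝ) A).continuous.measurable
  have hS : (A * K * A.transpose).PosSemidef := by
    simpa using hK.mul_mul_conjTranspose_same A
  have : IsProbabilityMeasure ((multivariateGaussian 0 K).map (act A)) :=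
    Measure.isProbabilityMeasure_map hm.aemeasurable
  refine Measure.ext_of_charFun ?_
  ext t
  have e : ∀ x : Par d, inner ℝ (act A x) t = inner ℝ x (act A.transpose t) := by
    intro x
    simp only [EuclideanSpace.inner_eq_star_dotProduct, act, star_trivial,
      Matrix.dotProduct_mulVec, Matrix.mulVec_transpose]
  rw [charFun_apply, integral_map hm.aemeasurable (by fun_prop)]
  simp_rw [e]
  rw [← charFun_apply, charFun_multivariateGaussian hK, charFun_multivariateGaussian hS]
  simp only [inner_zero_right, act, ← Matrix.mulVec_mulVec]
  rw [Matrix.dotProduct_mulVec t.ofLp A, ← Matrix.mulVec_transpose]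

/-- With constant `K`, the LAMN structure forces the law of `Z` under the parameter zero. -/
theorem IsLAMN.hasLaw_multivariateGaussian {P : Par d → Measure Ω'}
    [∀ θ, IsProbabilityMeasure (P θ)] {q : Ω' → C2 d} {Z : Ω' → Par d} {K : Mat d}
    (hK : K.PosDef) (h : IsLAMN P q Z fun _ => K) : HasLaw Z (multivariateGaussian 0 K) (P 0) := by
  refine hasLaw_multivariateGaussian_of_lintegral_exp (h.aemeasurable_Z 0) hK.posSemidef
    fun θ => ?_
  rw [← h.isLogLikelihood.lintegral_exp_sub_eq_one θ]
  refine lintegral_congr_ae ?_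
  filter_upwards [h.quadratic] with ω hω
  simp [hω]

theorem hasLaw_act_multivariateGaussian {ν : Measure Ω'} {Z : Ω' → Par d} {K : Mat d}
    (hK : K.PosSemidef) (h : HasLaw Z (multivariateGaussian 0 K) ν)
    (A : Mat d) :
    HasLaw (fun ω => act A (Z ω)) (multivariateGaussian 0 (A * K * A.transpose)) ν := by
  have hm : Measurable (act A) :=
    (Matrix.toEuclideanCLM (𝕜 := ℝ) A).continuous.measurable
  refine ⟨hm.comp_aemeasurable h.aemeasurable, ?_⟩
  rw [← map_act_multivariateGaussian hK A, ← h.map_eq,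
    AEMeasurable.map_map_of_aemeasurable hm.aemeasurable h.aemeasurable]
  rfl

/-! ### Derivatives of a quadratic -/

theorem isSymm_of_posSemidef {A : Mat d} (hA : A.PosSemidef) : A.IsSymm := by
  have h := hA.isHermitian
  rwa [Matrix.IsHermitian, Matrix.conjTranspose_eq_transpose_of_trivial] at h

theorem act_act (A B : Mat d) (v : Par d) : act A (act B v) = act (A * B) v := by
  simp [act]

theorem act_sub (A : Mat d) (v w : Par d) : act A (v - w) = act A v - act A w := by
  simp [act_eq_toEuclideanCLM]

theorem act_one (v : Par d) : act 1 v = v := by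
  simp [act]

theorem fderiv_quadratic (z : Par d) {K : Mat d} (hK : K.IsSymm) (x v : Par d) :
    fderiv ℝ (fun δ : Par d => δ.ofLp ⬝ᵥ z.ofLp - (1 / 2) * (δ.ofLp ⬝ᵥ K.mulVec δ.ofLp)) x v =
      inner ℝ v (z - act K x) := by
  have e : (fun δ : Par d => δ.ofLp ⬝ᵥ z.ofLp - (1 / 2) * (δ.ofLp ⬝ᵥ K.mulVec δ.ofLp)) =
      fun δ => inner ℝ δ z - (1 / 2) * inner ℝ δ (Matrix.toEuclideanCLM (𝕜 := ℝ) K δ) := by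
    ext δ
    rw [Matrix.inner_toEuclideanCLM]
    simp [EuclideanSpace.inner_eq_star_dotProduct, dotProduct_comm]
  have h := ((hasFDerivAt_id x).inner ℝ (hasFDerivAt_const z x)).sub
    (((hasFDerivAt_id x).inner ℝ
      (Matrix.toEuclideanCLM (𝕜 := ℝ) K).hasFDerivAt).const_mul (1 / 2))
  have hsymm : inner ℝ x (Matrix.toEuclideanCLM (𝕜 := ℝ) K v) =
      inner ℝ v (Matrix.toEuclideanCLM (𝕜 := ℝ) K x) := by
    rw [Matrix.inner_toEuclideanCLM, Matrix.inner_toEuclideanCLM, Matrix.dotProduct_mulVec,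
      ← Matrix.mulVec_transpose, hK.eq, dotProduct_comm]
  rw [e]
  refine (congrArg (fun L : Par d →L[ℝ] ℝ => L v) h.fderiv).trans ?_
  simp [hsymm, inner_sub_right, act_eq_toEuclideanCLM]
  ring

theorem C2.grad_of_quadratic {q : C2 d} {z : Par d} {K : Mat d} (hK : K.IsSymm)
    (hq : ∀ δ : Par d, q δ = δ.ofLp ⬝ᵥ z.ofLp - (1 / 2) * (δ.ofLp ⬝ᵥ K.mulVec δ.ofLp))
    (x : Par d) : q.grad x = z - act K x := by
  ext i
  change fderiv ℝ q.toFun x (C2.basisVec i) = _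
  rw [funext hq, fderiv_quadratic z hK]
  simp [C2.basisVec, EuclideanSpace.inner_single_left]

theorem C2.hess_of_quadratic {q : C2 d} {z : Par d} {K : Mat d} (hK : K.IsSymm)
    (hq : ∀ δ : Par d, q δ = δ.ofLp ⬝ᵥ z.ofLp - (1 / 2) * (δ.ofLp ⬝ᵥ K.mulVec δ.ofLp))
    (x : Par d) : q.hess x = -K := by
  ext i j
  change fderiv ℝ (fderiv ℝ q.toFun) x (C2.basisVec i) (C2.basisVec j) = _
  have hd : DifferentiableAt ℝ (fderiv ℝ q.toFun) x :=
    (q.contDiff.fderiv_right (m := 1) (by norm_num)).differentiable (by norm_num) x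
  have h1 : fderiv ℝ (fderiv ℝ q.toFun) x (C2.basisVec i) (C2.basisVec j) =
      fderiv ℝ (fun y => fderiv ℝ q.toFun y (C2.basisVec j)) x (C2.basisVec i) := by
    rw [fderiv_clm_apply hd (differentiableAt_const _)]
    simp
  have h2 : (fun y => fderiv ℝ q.toFun y (C2.basisVec j)) = fun y =>
      inner ℝ (C2.basisVec j) z -
        inner ℝ (C2.basisVec j) (Matrix.toEuclideanCLM (𝕜 := ℝ) K y) := by
    ext y
    rw [funext hq, fderiv_quadratic z hK, inner_sub_right, act_eq_toEuclideanCLM]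
  have h := (hasFDerivAt_const (inner ℝ (C2.basisVec j) z) x).sub
    ((hasFDerivAt_const (C2.basisVec j) x).inner ℝ
      (Matrix.toEuclideanCLM (𝕜 := ℝ) K).hasFDerivAt)
  rw [h1, h2]
  refine (congrArg (fun L : Par d →L[ℝ] ℝ => L (C2.basisVec i)) h.fderiv).trans ?_
  simp [C2.basisVec, EuclideanSpace.inner_single_left, hK.apply]

/-! ### The Newton step and the derived statistics -/

/-- The Newton step `δ + (-∇²q(δ))⁻¹ ∇q(δ)` as a total function of `(q, δ)`. Outside
`newtonDomain` its value is a junk value and is not used. -/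
noncomputable def newtonPoint (p : C2 d × Par d) : Par d :=
  p.2 + act (-p.1.hess p.2)⁻¹ (p.1.grad p.2)

variable (d) in
/-- The pairs at which the Newton map takes an ordinary value. -/
def newtonDomain : Set (C2 d × Par d) := {p | (-p.1.hess p.2).PosDef}

variable (d) in
/-- The pairs at which the standardized one-step estimator is an ordinary value: minus the Hessian
is positive definite both at the starting point and at the Newton step. -/
def sqrtDomain : Set (C2 d × Par d) :=
  newtonDomain d ∩ (fun p => (p.1, newtonPoint p)) ⁻¹' newtonDomain d

theorem isOpen_newtonDomain : IsOpen (newtonDomain d) :=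
  isOpen_posDef_of_isSymm C2.continuous_hess_apply.neg fun p => (p.1.isSymm_hess p.2).neg

theorem continuousOn_newtonPoint : ContinuousOn newtonPoint (newtonDomain d) := by
  intro p hp
  refine (continuous_snd.continuousAt.add (continuous_act.continuousAt.comp
    (ContinuousAt.prodMk ?_ C2.continuous_grad_apply.continuousAt))).continuousWithinAt
  exact ContinuousAt.comp (f := fun p : C2 d × Par d => -p.1.hess p.2)
    (continuousAt_inv_of_posDef hp) C2.continuous_hess_apply.neg.continuousAt

theorem continuousOn_prodMk_newtonPoint :
    ContinuousOn (fun p : C2 d × Par d => (p.1, newtonPoint p)) (newtonDomain d) :=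
  continuousOn_fst.prodMk continuousOn_newtonPoint

theorem isOpen_sqrtDomain : IsOpen (sqrtDomain d) :=
  continuousOn_prodMk_newtonPoint.isOpen_inter_preimage isOpen_newtonDomain isOpen_newtonDomain

theorem continuousOn_neg_hess_newtonPoint :
    ContinuousOn (fun p : C2 d × Par d => -p.1.hess (newtonPoint p)) (newtonDomain d) :=
  Continuous.comp_continuousOn (g := fun p : C2 d × Par d => -p.1.hess p.2)
    (f := fun p : C2 d × Par d => (p.1, newtonPoint p))
    C2.continuous_hess_apply.neg continuousOn_prodMk_newtonPoint

open MatrixOrder in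
theorem continuousOn_act_sqrt : ContinuousOn
    (fun p : C2 d × Par d => act (CFC.sqrt (-p.1.hess (newtonPoint p))) (newtonPoint p))
    (sqrtDomain d) :=
  continuous_act.comp_continuousOn <|
    (continuousOn_sqrt_posDef.comp (continuousOn_neg_hess_newtonPoint.mono Set.inter_subset_left)
      fun _ hp => hp.2).prodMk (continuousOn_newtonPoint.mono Set.inter_subset_left)

section
open Classical

theorem newton_eq_ite (p : C2 d × Par d) : newton p.1 (obj p.2) =
    if p ∈ newtonDomain d then obj (newtonPoint p) else NaO := rfl

theorem negHess_newton_eq_ite (p : C2 d × Par d) : negHess p.1 (newton p.1 (obj p.2)) =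
    if p ∈ newtonDomain d then obj (-p.1.hess (newtonPoint p)) else NaO := by
  rw [newton_eq_ite]
  split_ifs <;> rfl

open MatrixOrder in
theorem actNaO_sqrtNaO_eq_ite (p : C2 d × Par d) :
    actNaO (sqrtNaO (negHess p.1 (newton p.1 (obj p.2)))) (newton p.1 (obj p.2)) =
      if p ∈ sqrtDomain d then
        obj (act (CFC.sqrt (-p.1.hess (newtonPoint p))) (newtonPoint p)) else NaO := by
  rw [negHess_newton_eq_ite, newton_eq_ite]
  by_cases h1 : p ∈ newtonDomain d
  · by_cases h2 : (-p.1.hess (newtonPoint p)).PosDef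
    · have h : p ∈ sqrtDomain d := ⟨h1, h2⟩
      simp only [h1, h, if_true, sqrtNaO, h2, actNaO]
    · have h : p ∉ sqrtDomain d := fun h => h2 h.2
      simp only [h1, h, if_true, if_false, sqrtNaO, h2, actNaO]
  · have h : p ∉ sqrtDomain d := fun h => h1 h.1
    simp only [h1, h, if_false, sqrtNaO, actNaO]

end

/-- The statistics of the joint convergence as a function of `(q, δ)`: `q`, `δ`, `-∇²q(δ)`,
`-∇²q(δ̂)`, `δ̂` and `(-∇²q(δ̂))^{1/2} δ̂`, where `δ̂ = G(q, δ)`. -/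
noncomputable def newtonStatistics (p : C2 d × Par d) :
    C2 d × Par d × Mat d × WithNaO (Mat d) × WithNaO (Par d) × WithNaO (Par d) :=
  (p.1, p.2, -p.1.hess p.2, negHess p.1 (newton p.1 (obj p.2)), newton p.1 (obj p.2),
    actNaO (sqrtNaO (negHess p.1 (newton p.1 (obj p.2)))) (newton p.1 (obj p.2)))

theorem measurable_newtonStatistics : Measurable (newtonStatistics (d := d)) := by
  refine measurable_fst.prodMk (measurable_snd.prodMk
    (C2.continuous_hess_apply.neg.measurable.prodMk (Measurable.prodMk ?_
      (Measurable.prodMk ?_ ?_))))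
  · simp_rw [negHess_newton_eq_ite]
    exact measurable_ite_obj isOpen_newtonDomain continuousOn_neg_hess_newtonPoint
  · simp_rw [newton_eq_ite]
    exact measurable_ite_obj isOpen_newtonDomain continuousOn_newtonPoint
  · simp_rw [actNaO_sqrtNaO_eq_ite]
    exact measurable_ite_obj isOpen_sqrtDomain continuousOn_act_sqrt

theorem continuousOn_newtonStatistics :
    ContinuousOn (newtonStatistics (d := d)) (sqrtDomain d) := by
  have hsub : sqrtDomain d ⊆ newtonDomain d := Set.inter_subset_left
  refine continuousOn_fst.prodMk (continuousOn_snd.prodMk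
    (C2.continuous_hess_apply.neg.continuousOn.prodMk (ContinuousOn.prodMk ?_
      (ContinuousOn.prodMk ?_ ?_))))
  · simp_rw [negHess_newton_eq_ite]
    exact (continuousOn_ite_obj continuousOn_neg_hess_newtonPoint).mono hsub
  · simp_rw [newton_eq_ite]
    exact (continuousOn_ite_obj continuousOn_newtonPoint).mono hsub
  · simp_rw [actNaO_sqrtNaO_eq_ite]
    exact continuousOn_ite_obj continuousOn_act_sqrt

/-- For a quadratic, one Newton step from any point reaches the maximizer. -/
theorem newtonPoint_of_quadratic {q : C2 d} {z : Par d} {K : Mat d} (hK : K.PosDef)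
    (hq : ∀ δ : Par d, q δ = δ.ofLp ⬝ᵥ z.ofLp - (1 / 2) * (δ.ofLp ⬝ᵥ K.mulVec δ.ofLp))
    (δ : Par d) : newtonPoint (q, δ) = act K⁻¹ z := by
  have hs : K.IsSymm := isSymm_of_posSemidef hK.posSemidef
  rw [newtonPoint]
  simp only [C2.grad_of_quadratic hs hq, C2.hess_of_quadratic hs hq, neg_neg, act_sub, act_act]
  rw [Matrix.nonsing_inv_mul _ hK.det_pos.ne'.isUnit, act_one, add_sub_cancel]

theorem mem_sqrtDomain_of_quadratic {q : C2 d} {z : Par d} {K : Mat d} (hK : K.PosDef)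
    (hq : ∀ δ : Par d, q δ = δ.ofLp ⬝ᵥ z.ofLp - (1 / 2) * (δ.ofLp ⬝ᵥ K.mulVec δ.ofLp))
    (δ : Par d) : (q, δ) ∈ sqrtDomain d := by
  have hs : K.IsSymm := isSymm_of_posSemidef hK.posSemidef
  have h : ∀ x : Par d, (q, x) ∈ newtonDomain d := fun x => by
    simpa [newtonDomain, C2.hess_of_quadratic hs hq] using hK
  exact ⟨h _, h _⟩

section
open MatrixOrder

theorem isUnit_det_sqrt {K : Mat d} (hK : K.PosDef) : IsUnit (CFC.sqrt K).det := by
  have h := hK.det_pos.ne'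
  rw [← CFC.sqrt_mul_sqrt_self K hK.posSemidef.nonneg, Matrix.det_mul] at h
  exact (left_ne_zero_of_mul h).isUnit

theorem inv_sqrt_mul {K : Mat d} (hK : K.PosDef) : (CFC.sqrt K)⁻¹ * K = CFC.sqrt K := by
  nth_rw 2 [← CFC.sqrt_mul_sqrt_self K hK.posSemidef.nonneg]
  rw [Matrix.nonsing_inv_mul_cancel_left _ _ (isUnit_det_sqrt hK)]

theorem sqrt_mul_inv {K : Mat d} (hK : K.PosDef) : CFC.sqrt K * K⁻¹ = (CFC.sqrt K)⁻¹ := by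
  rw [← inv_sqrt_mul hK, Matrix.mul_assoc, Matrix.mul_nonsing_inv _ hK.det_pos.ne'.isUnit,
    Matrix.mul_one, inv_sqrt_mul hK]

end

open MatrixOrder in
theorem newtonStatistics_of_quadratic {q : C2 d} {z : Par d} {K : Mat d} (hK : K.PosDef)
    (hq : ∀ δ : Par d, q δ = δ.ofLp ⬝ᵥ z.ofLp - (1 / 2) * (δ.ofLp ⬝ᵥ K.mulVec δ.ofLp))
    (δ : Par d) : newtonStatistics (q, δ) =
      (q, δ, K, obj K, obj (act K⁻¹ z), obj (act (CFC.sqrt K)⁻¹ z)) := by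
  have hs : K.IsSymm := isSymm_of_posSemidef hK.posSemidef
  have hmem := mem_sqrtDomain_of_quadratic hK hq δ
  rw [newtonStatistics, actNaO_sqrtNaO_eq_ite, negHess_newton_eq_ite, newton_eq_ite]
  simp only [hmem, hmem.1, if_true, newtonPoint_of_quadratic hK hq, C2.hess_of_quadratic hs hq,
    neg_neg, act_act, sqrt_mul_inv hK]

end Quadraticity

open Quadraticity
open MatrixOrder in
theorem corollary2 {d : ℕ}
    {Ω : ℕ → Type*} [∀ n, MeasurableSpace (Ω n)]
    (μ : (n : ℕ) → Measure (Ω n)) [∀ n, IsProbabilityMeasure (μ n)]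
    {Ω' : Type*} [MeasurableSpace Ω']
    (P : Par d → Measure Ω') [∀ θ, IsProbabilityMeasure (P θ)]
    (q : (n : ℕ) → Ω n → C2 d) (δt : (n : ℕ) → Ω n → Par d)
    (δhat : (n : ℕ) → Ω n → WithNaO (Par d))
    (hδhat : ∀ n ω, δhat n ω = newton (q n ω) (obj (δt n ω)))
    (qlim : Ω' → C2 d) (δlim : Ω' → Par d)
    (hconv : TendstoInDistribution (fun n ω => (q n ω, δt n ω)) atTop
      (fun ω => (qlim ω, δlim ω)) μ (P 0))
    (Z : Ω' → Par d) (K : Mat d)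
    (hLAMN : IsLAMN P qlim Z (fun _ => K)) :
    TendstoInDistribution δhat atTop (obj : Par d → WithNaO (Par d)) μ
        (multivariateGaussian 0 K⁻¹) ∧
      HasLaw (fun ω => act K⁻¹ (Z ω)) (multivariateGaussian 0 K⁻¹) (P 0) ∧
      HasLaw (fun ω => act (CFC.sqrt K)⁻¹ (Z ω)) (multivariateGaussian 0 1) (P 0) ∧
      TendstoInDistribution
        (fun n ω => (q n ω, δt n ω, -(q n ω).hess (δt n ω), negHess (q n ω) (δhat n ω),
          δhat n ω, actNaO (sqrtNaO (negHess (q n ω) (δhat n ω))) (δhat n ω)))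
        atTop
        (fun ω => (qlim ω, δlim ω, K, (obj K : WithNaO (Mat d)),
          (obj (act K⁻¹ (Z ω)) : WithNaO (Par d)),
          (obj (act (CFC.sqrt K)⁻¹ (Z ω)) : WithNaO (Par d))))
        μ (P 0) := by
  obtain rfl : δhat = fun n ω => newton (q n ω) (obj (δt n ω)) := funext₂ hδhat
  have hK : K.PosDef := hLAMN.posDef.exists.choose_spec
  have hZ := hLAMN.hasLaw_multivariateGaussian hK
  have hKu : IsUnit K.det := hK.det_pos.ne'.isUnit
  have hlaw : HasLaw (fun ω => act K⁻¹ (Z ω)) (multivariateGaussian 0 K⁻¹) (P 0) := by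
    have h := hasLaw_act_multivariateGaussian hK.posSemidef hZ K⁻¹
    rwa [Matrix.nonsing_inv_mul _ hKu, one_mul, (isSymm_of_posSemidef hK.inv.posSemidef).eq] at h
  have hlaw' : HasLaw (fun ω => act (CFC.sqrt K)⁻¹ (Z ω)) (multivariateGaussian 0 1) (P 0) := by
    have h := hasLaw_act_multivariateGaussian hK.posSemidef hZ (CFC.sqrt K)⁻¹
    have hs : (CFC.sqrt K)⁻¹.IsSymm :=
      isSymm_of_posSemidef (Matrix.nonneg_iff_posSemidef.1 (CFC.sqrt_nonneg K)).inv
    rwa [hs.eq, inv_sqrt_mul hK, Matrix.mul_nonsing_inv _ (isUnit_det_sqrt hK)] at h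
  have hjoint := (tendstoInDistribution_comp_of_continuousOn_isOpen hconv
    measurable_newtonStatistics isOpen_sqrtDomain continuousOn_newtonStatistics
    (hLAMN.quadratic.mono fun ω hω => mem_sqrtDomain_of_quadratic hK hω (δlim ω))).congr
    (fun _ => EventuallyEq.rfl)
    (hLAMN.quadratic.mono fun ω hω => newtonStatistics_of_quadratic hK hω (δlim ω))
  refine ⟨?_, hlaw, hlaw', hjoint⟩
  -- The marginal convergence is the projection of the joint one to its fifth coordinate.
  have h5 := hjoint.continuous_comp (g := fun p => p.2.2.2.2.1) (by fun_prop)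
  refine ⟨h5.forall_aemeasurable, measurable_inl.aemeasurable, ?_⟩
  convert! h5.tendsto using 2
  refine congrArg 𝓝 (Subtype.ext ?_)
  change (multivariateGaussian 0 K⁻¹).map obj = (P 0).map (obj ∘ fun ω => act K⁻¹ (Z ω))
  rw [← hlaw.map_eq]
  exact AEMeasurable.map_map_of_aemeasurable measurable_inl.aemeasurable hlaw.aemeasurable
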